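/- All spaces are Tychonoff (completely regular and $T_0$). Let $E$ be a space that is a $k$-space (a set $A\subseteq E$ is closed whenever $A\cap K$ is closed in $K$ for every compact $K\subseteq E$), equipped with a partition $E=\bigsqcup_{n\ge 0}E_n$ into clopen (possibly empty) subsets; the elements of $E_n$ are the $n$-ary operation symbols. An $E$-algebra is a set $X$ together with maps $\Psi^X_n\colon E_n\times X^n\to X$, $n\ge 0$. An $E$-algebra $X$ with a topology is called a topological $E$-algebra if all the maps $\Psi^X_n$ are continuous, and a semitopological $E$-algebra if all the maps $\Psi^X_n$ are separately continuous, that is, continuous in each of the $n+1$ variables in $E_n,X,\dots,X$ when the other $n$ variables are fixed. Let $X$ be a topological $E$-algebra whose underlying space is pseudocompact (Tychonoff, and every continuous function $X\to\mathbb R$ is bounded), and let $\beta X$ be its Stone–Čech compactification. Then for every $n\ge 0$ the map $\Psi^X_n$ extends to a separately continuous map $\Psi^{\beta X}_n\colon E_n\times(\beta X)^n\to\beta X$. That is, $\beta X$ carries the structure of a semitopological $E$-algebra for which the canonical embedding $X\to\beta X$ is a homomorphism. -/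

import Mathlib

/-- A Tychonoff space on which every continuous real-valued function is bounded. -/
class PseudocompactSpace (X : Type*) [TopologicalSpace X] : Prop extends T35Space X where
  exists_bound : ∀ f : X → ℝ, Continuous f → ∃ C : ℝ, ∀ x, |f x| ≤ C

/-- The structure of a continuous signature on a topological space `E`: each symbol has a finite
arity, and the set `E_n` of symbols of arity `n` is clopen for every `n`. -/
structure ContinuousSignature (E : Type*) [TopologicalSpace E] where
  arity : E → ℕ
  isClopen_fiber : ∀ n, IsClopen (arity ⁻¹' {n})

/-- The subspace `E_n` of `n`-ary symbols, with the subspace topology. -/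
abbrev ContinuousSignature.Symbols {E : Type*} [TopologicalSpace E] (σ : ContinuousSignature E)
    (n : ℕ) : Type _ :=
  {t : E // σ.arity t = n}

/-- An `E`-algebra structure on `X`: a family of maps `Ψ_n : E_n × X ^ n → X`. -/
structure EAlgebra {E : Type*} [TopologicalSpace E] (σ : ContinuousSignature E) (X : Type*) where
  op : (n : ℕ) → σ.Symbols n × (Fin n → X) → X

/-- Separate continuity of a map `T × X ^ n → Y`, as a map of its `n + 1` arguments. -/
def IsSeparatelyContinuous {T X Y : Type*} [TopologicalSpace T] [TopologicalSpace X]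
    [TopologicalSpace Y] {n : ℕ} (Φ : T × (Fin n → X) → Y) : Prop :=
  (∀ x : Fin n → X, Continuous fun t : T => Φ (t, x)) ∧
    ∀ (t : T) (x : Fin n → X) (i : Fin n), Continuous fun y : X => Φ (t, Function.update x i y)

namespace EAlgebra

variable {E : Type*} [TopologicalSpace E] {σ : ContinuousSignature E} {X Y : Type*}

/-- Topological `E`-algebra: all maps `Ψ_n : E_n × X ^ n → X` are jointly continuous. -/
def IsTopological [TopologicalSpace X] (A : EAlgebra σ X) : Prop :=
  ∀ n, Continuous (A.op n)

/-- Semitopological `E`-algebra: all maps `Ψ_n : E_n × X ^ n → X` are separately continuous. -/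
def IsSemitopological [TopologicalSpace X] (A : EAlgebra σ X) : Prop :=
  ∀ n, IsSeparatelyContinuous (A.op n)

/-- Homomorphisms of `E`-algebras. -/
def IsHom (A : EAlgebra σ X) (B : EAlgebra σ Y) (φ : X → Y) : Prop :=
  ∀ (n : ℕ) (t : σ.Symbols n) (x : Fin n → X), φ (A.op n (t, x)) = B.op n (t, φ ∘ x)

end EAlgebra

open Filter Topology Function Set

/-! For a fixed symbol, the map `X ^ n → β X` is extended by enlarging the set `S` of variables
allowed to leave `X`. Given the extension for `S.erase j`, the Stone–Čech property extends it in
variable `j`, once it is known to be continuous in `j` on `X`. Joint continuity of the operation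
proves this when `S` has two elements; when `S` has at least three, it follows from the extensions
for the smaller sets (`continuous_of_three_variables`). The other variables of `S` stay separately
continuous by `continuous_right_of_compactSpace`, which also gives continuity in the symbol on
compact sets, hence everywhere in a `k`-space. All three continuity lemmas are double-limit
arguments: discontinuity yields sequences whose two iterated limits differ, and pseudocompactness
rules this out. -/

/-! ### Cluster points and `G_δ`-density -/

/-- In a pseudocompact space every sequence of nonempty open sets has a cluster point. -/
theorem PseudocompactSpace.exists_cluster {X : Type*} [TopologicalSpace X] [PseudocompactSpace X]
    (V : ℕ → Set X) (hV : ∀ n, IsOpen (V n)) (hne : ∀ n, (V n).Nonempty) :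
    ∃ x, ∀ C : Set X, IsClosed C → (∀ᶠ n in atTop, V n ⊆ C) → x ∈ C := by
  by_contra! hcon
  choose x hx using hne
  have hlf : LocallyFinite V := by
    intro y
    obtain ⟨C, hC, hev, hy⟩ := hcon y
    refine ⟨Cᶜ, hC.isOpen_compl.mem_nhds hy, ?_⟩
    rw [← Nat.cofinite_eq_atTop] at hev
    refine hev.subset ?_
    rintro n ⟨z, hz, hz'⟩ hsub
    exact hz' (hsub hz)
  have hφ : ∀ n, ∃ φ : X → ℝ, Continuous φ ∧ (∀ y, 0 ≤ φ y) ∧ φ (x n) = 1 ∧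
      ∀ y, y ∉ V n → φ y = 0 := by
    intro n
    obtain ⟨g, hg, h0, h1⟩ := CompletelyRegularSpace.completely_regular (x n) (V n)ᶜ
      (hV n).isClosed_compl (by simpa using hx n)
    refine ⟨fun y => 1 - (g y : ℝ), by fun_prop, fun y => by linarith [(g y).2.2], by simp [h0],
      fun y hy => by simp [h1 hy]⟩
  choose φ hφc hφ0 hφ1 hφV using hφ
  -- The sum of the `n * φ n` is continuous by local finiteness and at least `n` at `x n`, so it is
  -- unbounded.
  have hsupp : LocallyFinite fun n : ℕ => support fun y => (n : ℝ) * φ n y :=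
    hlf.subset fun n y hy => by
      by_contra hy'
      exact hy (by simp [hφV n y hy'])
  obtain ⟨C, hC⟩ := PseudocompactSpace.exists_bound _
    (continuous_finsum (fun n => continuous_const.mul (hφc n)) hsupp)
  obtain ⟨n, hn⟩ := exists_nat_gt C
  have h1 : |∑ᶠ m : ℕ, (m : ℝ) * φ m (x n)| ≤ C := hC (x n)
  have h2 : (n : ℝ) * φ n (x n) ≤ ∑ᶠ m : ℕ, (m : ℝ) * φ m (x n) :=
    single_le_finsum n (hsupp.point_finite (x n)) fun m => mul_nonneg m.cast_nonneg (hφ0 m _)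
  rw [hφ1, mul_one] at h2
  linarith [le_abs_self (∑ᶠ m : ℕ, (m : ℝ) * φ m (x n))]

theorem exists_cluster_of_compactSpace {K : Type*} [TopologicalSpace K] [CompactSpace K]
    (u : ℕ → K) : ∃ y, ∀ C : Set K, IsClosed C → (∀ᶠ n in atTop, u n ∈ C) → y ∈ C := by
  obtain ⟨y, hy⟩ := exists_clusterPt_of_compactSpace (map u atTop)
  refine ⟨y, fun C hC hev => ?_⟩
  by_contra hyC
  obtain ⟨n, hn, hn'⟩ := ((mapClusterPt_iff_frequently.1 hy _
    (hC.isOpen_compl.mem_nhds hyC)).and_eventually hev).exists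
  exact hn hn'

/-- A pseudocompact space is `G_δ`-dense in each of its compactifications: countably many
continuous functions take simultaneously their values at a given point on it. -/
theorem PseudocompactSpace.exists_forall_eq {X K κ : Type*} [TopologicalSpace X]
    [PseudocompactSpace X] [TopologicalSpace K] {e : X → K} (he : Continuous e)
    (hd : DenseRange e) [Countable κ] [Nonempty κ] (g : κ → K → ℝ) (hg : ∀ k, Continuous (g k))
    (q : K) : ∃ x, ∀ k, g k (e x) = g k q := by
  obtain ⟨s, hs⟩ := exists_surjective_nat κ
  -- `W n` imposes the first `n + 1` conditions up to `1 / (n + 1)`; a cluster point satisfies all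
  -- of them exactly.
  let W : ℕ → Set K := fun n => ⋂ k ∈ Finset.range (n + 1),
    {y | dist (g (s k) y) (g (s k) q) < 1 / ((n : ℝ) + 1)}
  have hW : ∀ n, IsOpen (W n) := fun n => isOpen_biInter_finset fun k _ =>
    isOpen_lt ((hg (s k)).dist continuous_const) continuous_const
  have hqW : ∀ n, q ∈ W n := fun n => by
    simp only [W, mem_iInter, mem_ofPred_eq, dist_self]
    intros
    positivity
  obtain ⟨x, hx⟩ := PseudocompactSpace.exists_cluster (fun n => e ⁻¹' W n)
    (fun n => (hW n).preimage he) fun n => by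
      obtain ⟨y, hy⟩ := hd.exists_mem_open (hW n) ⟨q, hqW n⟩
      exact ⟨y, hy⟩
  refine ⟨x, fun k => ?_⟩
  obtain ⟨k, rfl⟩ := hs k
  refine dist_le_zero.1 (le_of_forall_pos_le_add fun ε hε => ?_)
  rw [zero_add]
  obtain ⟨N, hN⟩ := exists_nat_one_div_lt hε
  refine hx {x | dist (g (s k) (e x)) (g (s k) q) ≤ ε}
    (isClosed_le (((hg (s k)).comp he).dist continuous_const) continuous_const) ?_
  filter_upwards [eventually_ge_atTop (max N k)] with n hn y hy
  have h1 : dist (g (s k) (e y)) (g (s k) q) < 1 / ((n : ℝ) + 1) := by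
    have := mem_iInter₂.1 hy k (Finset.mem_range.2 (by have := le_max_right N k; omega))
    exact this
  have h2 : 1 / ((n : ℝ) + 1) ≤ 1 / ((N : ℝ) + 1) := by
    have : (N : ℝ) ≤ n := by exact_mod_cast (le_max_left N k).trans hn
    gcongr
  exact (h1.trans_le h2).le.trans hN.le

/-! ### Double-limit arguments -/

theorem exists_frequently_le_dist_of_not_continuous {X : Type*} [TopologicalSpace X] {h : X → ℝ}
    (hh : ¬ Continuous h) : ∃ x₀, ∃ ε > 0, ∃ᶠ x in 𝓝 x₀, ε ≤ dist (h x) (h x₀) := by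
  simpa [continuous_iff_continuousAt, ContinuousAt, Metric.tendsto_nhds, not_forall,
    not_lt] using hh

/-- A separately continuous function on the product of a pseudocompact space and a compact space
extends separately continuously in the first variable. -/
theorem PseudocompactSpace.continuous_right_of_compactSpace {X K L : Type*} [TopologicalSpace X]
    [PseudocompactSpace X] [TopologicalSpace K] [CompactSpace K] [TopologicalSpace L]
    [CompactSpace L] {e : X → K} (he : Continuous e) (hd : DenseRange e) (G : K → L → ℝ)
    (h₁ : ∀ b, Continuous fun a => G a b) (h₂ : ∀ x, Continuous (G (e x))) (p : K) :
    Continuous (G p) := by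
  by_contra hcon
  obtain ⟨q₀, ε, hε, hfr⟩ := exists_frequently_le_dist_of_not_continuous hcon
  set c := G p q₀ with hc
  -- For `n < m`, the value at `(x n, b m)` is near `c` and the value at `(x m, b n)` is far from
  -- it.
  obtain ⟨d, hP, hr⟩ := exists_seq_of_forall_finset_exists
    (fun d : X × L => dist (G (e d.1) q₀) c < ε / 3 ∧ 2 * ε / 3 < dist (G (e d.1) d.2) c ∧
      ε ≤ dist (G p d.2) c)
    (fun d d' => 2 * ε / 3 < dist (G (e d'.1) d.2) c ∧ dist (G (e d.1) d'.2) c < ε / 3) (by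
      intro s hs
      have hev : ∀ᶠ b in 𝓝 q₀, ∀ d ∈ s, dist (G (e d.1) b) c < ε / 3 :=
        (Finset.eventually_all s).2 fun d hd => (((h₂ d.1).dist continuous_const).tendsto q₀)
          |>.eventually (gt_mem_nhds (hs d hd).1)
      obtain ⟨b, hb, hbs⟩ := (hfr.and_eventually hev).exists
      have hfar : ∀ b', ε ≤ dist (G p b') c → ∀ᶠ a in 𝓝 p, 2 * ε / 3 < dist (G a b') c :=
        fun b' hb' => (((h₁ b').dist continuous_const).tendsto p).eventually
          (lt_mem_nhds (by linarith))
      have hclose : ∀ᶠ a in 𝓝 p, dist (G a q₀) c < ε / 3 :=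
        (((h₁ q₀).dist continuous_const).tendsto p).eventually
          (gt_mem_nhds (by rw [hc, dist_self]; positivity))
      have hall := (hclose.and (hfar b hb)).and
        ((Finset.eventually_all s).2 fun d hd => hfar d.2 (hs d hd).2.2)
      obtain ⟨x, hx⟩ := hd.exists_mem_open isOpen_interior ⟨p, mem_interior_iff_mem_nhds.2 hall⟩
      have hx := interior_subset hx
      exact ⟨(x, b), ⟨hx.1.1, hx.1.2, hb⟩, fun d hd => ⟨hx.2 d hd, hbs d hd⟩⟩)
  obtain ⟨q, hq⟩ := exists_cluster_of_compactSpace fun n => (d n).2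
  obtain ⟨p', hp'⟩ := exists_cluster_of_compactSpace fun n => e (d n).1
  have hpq : dist (G p' q) c ≤ ε / 3 := by
    refine hp' {a | dist (G a q) c ≤ ε / 3}
      (isClosed_le ((h₁ q).dist continuous_const) continuous_const) (.of_forall fun n => ?_)
    refine hq {b | dist (G (e (d n).1) b) c ≤ ε / 3}
      (isClosed_le ((h₂ _).dist continuous_const) continuous_const) ?_
    filter_upwards [eventually_gt_atTop n] with m hm
    exact (hr n m hm).2.le
  have hpm : ∀ m, 2 * ε / 3 ≤ dist (G p' (d m).2) c := by
    intro m
    refine hp' {a | 2 * ε / 3 ≤ dist (G a (d m).2) c}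
      (isClosed_le continuous_const ((h₁ _).dist continuous_const)) ?_
    filter_upwards [eventually_gt_atTop m] with n hn
    exact (hr m n hn).1.le
  -- `G p'` need not be continuous, but it agrees on the countable set of `q` and all `b m` with
  -- some `G (e x)`, which is.
  obtain ⟨x, hx⟩ := PseudocompactSpace.exists_forall_eq he hd
    (fun (k : Option ℕ) a => G a (k.elim q fun m => (d m).2)) (fun k => h₁ _) p'
  have hxq : G (e x) q = G p' q := hx none
  have hxm : ∀ m, G (e x) (d m).2 = G p' (d m).2 := fun m => hx (some m)
  have : 2 * ε / 3 ≤ dist (G (e x) q) c :=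
    hq {b | 2 * ε / 3 ≤ dist (G (e x) b) c}
      (isClosed_le continuous_const ((h₂ x).dist continuous_const))
      (.of_forall fun m => by simpa only [mem_ofPred_eq, hxm] using hpm m)
  rw [hxq] at this
  linarith

/-- The extension in the first variable of a continuous function on the product of two
pseudocompact spaces is continuous in the second variable. -/
theorem PseudocompactSpace.continuous_right_of_continuous {X Y K : Type*} [TopologicalSpace X]
    [PseudocompactSpace X] [TopologicalSpace Y] [PseudocompactSpace Y] [TopologicalSpace K]
    {e : Y → K} (hd : DenseRange e) (G : K → X → ℝ) (h₁ : ∀ x, Continuous fun a => G a x)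
    (h₂ : Continuous fun z : Y × X => G (e z.1) z.2) (q : K) : Continuous (G q) := by
  by_contra hcon
  obtain ⟨x₀, ε, hε, hfr⟩ := exists_frequently_le_dist_of_not_continuous hcon
  set c := G q x₀ with hc
  have hl : ∀ y, Continuous (G (e y)) := fun y =>
    h₂.comp (Continuous.prodMk continuous_const continuous_id)
  have hr : ∀ x, Continuous fun y => G (e y) x := fun x =>
    h₂.comp (Continuous.prodMk continuous_id continuous_const)
  -- Joint continuity supplies boxes `V n × U n` on which `G` is near `c`, while on later `V m` the
  -- value at the earlier point `x n` is far from `c`.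
  obtain ⟨d, hP, hd⟩ := exists_seq_of_forall_finset_exists
    (fun d : Set Y × Set X × X => IsOpen d.1 ∧ d.1.Nonempty ∧ IsOpen d.2.1 ∧ x₀ ∈ d.2.1 ∧
      d.2.2 ∈ d.2.1 ∧ (∀ y ∈ d.1, ∀ x ∈ d.2.1, dist (G (e y) x) c < ε / 3) ∧
      ε ≤ dist (G q d.2.2) c)
    (fun d d' => (∀ y ∈ d'.1, 2 * ε / 3 < dist (G (e y) d.2.2) c) ∧ d'.2.2 ∈ d.2.1) (by
      intro s hs
      have hall : ∀ᶠ a in 𝓝 q, dist (G a x₀) c < ε / 3 ∧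
          ∀ d ∈ s, 2 * ε / 3 < dist (G a d.2.2) c :=
        ((((h₁ x₀).dist continuous_const).tendsto q).eventually
          (gt_mem_nhds (by rw [← hc, dist_self]; positivity))).and
        ((Finset.eventually_all s).2 fun d hd => (((h₁ _).dist continuous_const).tendsto q)
          |>.eventually (lt_mem_nhds (by linarith [(hs d hd).2.2.2.2.2.2])))
      obtain ⟨y, hy⟩ := hd.exists_mem_open isOpen_interior ⟨q, mem_interior_iff_mem_nhds.2 hall⟩
      have hy := interior_subset hy
      have hopen : IsOpen {z : Y × X | dist (G (e z.1) z.2) c < ε / 3} :=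
        isOpen_lt (h₂.dist continuous_const) continuous_const
      obtain ⟨V, U, hV, hU, hyV, hxU, hVU⟩ := isOpen_prod_iff.1 hopen y x₀ hy.1
      have hVs : IsOpen (⋂ d ∈ s, {y | 2 * ε / 3 < dist (G (e y) d.2.2) c}) :=
        isOpen_biInter_finset fun d _ =>
          isOpen_lt continuous_const ((hr _).dist continuous_const)
      have hUs : ∀ᶠ x in 𝓝 x₀, x ∈ U ∧ ∀ d ∈ s, x ∈ d.2.1 :=
        (hU.eventually_mem hxU).and ((Finset.eventually_all s).2 fun d hd =>
          (hs d hd).2.2.1.eventually_mem (hs d hd).2.2.2.1)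
      obtain ⟨x, hx, hxU', hxs⟩ := (hfr.and_eventually hUs).exists
      refine ⟨(V ∩ ⋂ d ∈ s, {y | 2 * ε / 3 < dist (G (e y) d.2.2) c}, U, x),
        ⟨hV.inter hVs, ⟨y, hyV, mem_iInter₂.2 fun d hd => hy.2 d hd⟩, hU, hxU, hxU',
          fun y hy x hx => hVU (mk_mem_prod hy.1 hx), hx⟩, fun d hd => ⟨fun y hy =>
            mem_iInter₂.1 hy.2 d hd, hxs d hd⟩⟩)
  choose hVo hVn hUo hx₀ hxU hclose hfar using hP
  obtain ⟨y, hy⟩ := PseudocompactSpace.exists_cluster (fun n => (d n).1) hVo hVn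
  have hyn : ∀ n, 2 * ε / 3 ≤ dist (G (e y) (d n).2.2) c := by
    intro n
    refine hy {y | 2 * ε / 3 ≤ dist (G (e y) (d n).2.2) c}
      (isClosed_le continuous_const ((hr _).dist continuous_const)) ?_
    filter_upwards [eventually_gt_atTop n] with m hm z hz
    exact ((hd n m hm).1 z hz).le
  -- The bound `ε / 2`, strictly between `ε / 3` and `2 * ε / 3`, makes the condition open while the
  -- points `(d n).2.2` still satisfy it.
  obtain ⟨x, hx⟩ := PseudocompactSpace.exists_cluster
    (fun n => (⋂ k ∈ Finset.range (n + 1), (d k).2.1) ∩ {x | ε / 2 < dist (G (e y) x) c})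
    (fun n => (isOpen_biInter_finset fun k _ => hUo k).inter
      (isOpen_lt continuous_const ((hl y).dist continuous_const)))
    (fun n => ⟨(d n).2.2, mem_iInter₂.2 fun k hk => by
      rcases (Finset.mem_range_succ_iff.1 hk).lt_or_eq with h | rfl
      · exact (hd k n h).2
      · exact hxU k, by
      have := hyn n
      rw [mem_ofPred_eq]
      linarith⟩)
  have h1 : ε / 2 ≤ dist (G (e y) x) c :=
    hx {x | ε / 2 ≤ dist (G (e y) x) c}
      (isClosed_le continuous_const ((hl y).dist continuous_const))
      (.of_forall fun n z hz => (le_of_lt hz.2 : ε / 2 ≤ dist (G (e y) z) c))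
  have h2 : ∀ m, ∀ z ∈ (d m).1, dist (G (e z) x) c ≤ ε / 3 := by
    intro m z hz
    refine hx {x | dist (G (e z) x) c ≤ ε / 3}
      (isClosed_le ((hl z).dist continuous_const) continuous_const) ?_
    filter_upwards [eventually_ge_atTop m] with n hn w hw
    exact (hclose m z hz w (mem_iInter₂.1 hw.1 m (Finset.mem_range_succ_iff.2 hn))).le
  have h3 : dist (G (e y) x) c ≤ ε / 3 :=
    hy {y | dist (G (e y) x) c ≤ ε / 3}
      (isClosed_le ((hr x).dist continuous_const) continuous_const)
      (.of_forall fun m z hz => h2 m z hz)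
  linarith

/-- Let `G` be a function of three variables, defined when one of them lies in a pseudocompact
space `X` and the other two in a compactification of `X`. If `G` is continuous in the latter
variables, then it is continuous on `X` in the third variable when the first two are fixed. -/
theorem PseudocompactSpace.continuous_of_three_variables {X K : Type*} [TopologicalSpace X]
    [PseudocompactSpace X] [TopologicalSpace K] [CompactSpace K] {e : X → K} (he : Continuous e)
    (hd : DenseRange e) (G₁ : X → K → K → ℝ) (G₂ : K → X → K → ℝ) (G₃ : K → K → X → ℝ)
    (h₁₃ : ∀ x b z, G₁ x b (e z) = G₃ (e x) b z)
    (h₁₂ : ∀ x y z, G₁ x (e y) (e z) = G₂ (e x) y (e z))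
    (hc₁ : ∀ x z, Continuous fun b => G₁ x b z) (hc₁' : ∀ x b, Continuous fun z => G₁ x b z)
    (hc₂ : ∀ y z, Continuous fun a => G₂ a y z) (hc₂' : ∀ a y, Continuous fun z => G₂ a y z)
    (hc₃ : ∀ b z, Continuous fun a => G₃ a b z) (p q : K) : Continuous (G₃ p q) := by
  by_contra hcon
  obtain ⟨z₀, ε, hε, hfr⟩ := exists_frequently_le_dist_of_not_continuous hcon
  set c := G₃ p q z₀ with hc
  obtain ⟨d, hP, hr⟩ := exists_seq_of_forall_finset_exists
    (fun d : X × X => dist (G₁ d.1 q (e z₀)) c < ε / 3 ∧ dist (G₁ d.1 q (e d.2)) c < ε / 3 ∧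
      ε ≤ dist (G₃ p q d.2) c)
    (fun d d' => 2 * ε / 3 < dist (G₁ d'.1 q (e d.2)) c ∧ dist (G₁ d.1 q (e d'.2)) c < ε / 3) (by
      intro s hs
      have hall : ∀ᶠ a in 𝓝 p, dist (G₃ a q z₀) c < ε / 3 ∧
          ∀ d ∈ s, 2 * ε / 3 < dist (G₃ a q d.2) c :=
        ((((hc₃ q z₀).dist continuous_const).tendsto p).eventually
          (gt_mem_nhds (by rw [← hc, dist_self]; positivity))).and
        ((Finset.eventually_all s).2 fun d hd => (((hc₃ q _).dist continuous_const).tendsto p)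
          |>.eventually (lt_mem_nhds (by linarith [(hs d hd).2.2])))
      obtain ⟨a, ha⟩ := hd.exists_mem_open isOpen_interior ⟨p, mem_interior_iff_mem_nhds.2 hall⟩
      have ha := interior_subset ha
      have hz : ∀ x, dist (G₁ x q (e z₀)) c < ε / 3 →
          ∀ᶠ z in 𝓝 z₀, dist (G₁ x q (e z)) c < ε / 3 := fun x hx =>
        ((((hc₁' x q).comp he).dist continuous_const).tendsto z₀).eventually (gt_mem_nhds hx)
      have ha' : dist (G₁ a q (e z₀)) c < ε / 3 := by rw [h₁₃]; exact ha.1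
      obtain ⟨z, hzf, hza, hzs⟩ := (hfr.and_eventually ((hz a ha').and
        ((Finset.eventually_all s).2 fun d hd => hz d.1 (hs d hd).1))).exists
      exact ⟨(a, z), ⟨ha', hza, hzf⟩, fun d hd => ⟨by rw [h₁₃]; exact ha.2 d hd, hzs d hd⟩⟩)
  -- Replacing `q` by a point `y` of `X` preserves the whole double sequence. Then `G₂` lets both
  -- other variables range over `K`, so both iterated limits equal the value at the cluster points.
  obtain ⟨y, hy⟩ := PseudocompactSpace.exists_forall_eq he hd
    (fun (k : ℕ × ℕ) b => G₁ (d k.1).1 b (e (d k.2).2)) (fun k => hc₁ _ _) q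
  have hy' : ∀ n m, G₂ (e (d n).1) y (e (d m).2) = G₁ (d n).1 q (e (d m).2) := fun n m => by
    rw [← h₁₂]
    exact hy (n, m)
  obtain ⟨a, ha⟩ := exists_cluster_of_compactSpace fun n => e (d n).1
  obtain ⟨z, hz⟩ := exists_cluster_of_compactSpace fun n => e (d n).2
  have hle : dist (G₂ a y z) c ≤ ε / 3 := by
    refine ha {a | dist (G₂ a y z) c ≤ ε / 3}
      (isClosed_le ((hc₂ _ _).dist continuous_const) continuous_const) (.of_forall fun n => ?_)
    refine hz {z | dist (G₂ (e (d n).1) y z) c ≤ ε / 3}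
      (isClosed_le ((hc₂' _ _).dist continuous_const) continuous_const) ?_
    filter_upwards [eventually_gt_atTop n] with m hm
    rw [hy']
    exact (hr n m hm).2.le
  have hge : 2 * ε / 3 ≤ dist (G₂ a y z) c := by
    refine hz {z | 2 * ε / 3 ≤ dist (G₂ a y z) c}
      (isClosed_le continuous_const ((hc₂' _ _).dist continuous_const)) (.of_forall fun m => ?_)
    refine ha {a | 2 * ε / 3 ≤ dist (G₂ a y (e (d m).2)) c}
      (isClosed_le continuous_const ((hc₂ _ _).dist continuous_const)) ?_
    filter_upwards [eventually_gt_atTop m] with n hn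
    rw [hy']
    exact (hr m n hn).1.le
  linarith

/-! ### Extension to finite powers -/

theorem continuous_of_forall_continuous_comp {W Z : Type*} [TopologicalSpace W]
    [TopologicalSpace Z] [CompletelyRegularSpace Z] {h : W → Z}
    (H : ∀ φ : Z → ℝ, Continuous φ → Continuous fun w => φ (h w)) : Continuous h := by
  refine continuous_iff_continuousAt.2 fun w => tendsto_nhds.2 fun O hO hw => ?_
  obtain ⟨g, hg, h0, h1⟩ := CompletelyRegularSpace.completely_regular (h w) Oᶜ
    hO.isClosed_compl (by simpa using hw)
  have := ((H (fun z => (g z : ℝ)) (by fun_prop)).tendsto w).eventually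
    (gt_mem_nhds (show (g (h w) : ℝ) < 1 by simp [h0]))
  filter_upwards [this] with v hv
  by_contra hvO
  simp [h1 hvO] at hv

/-- `F` extends `f : X ^ ι → Z` to `(β X) ^ ι`, and it is continuous in each of the variables from
`S` as long as the variables outside `S` stay in `X`. -/
structure IsSepExtension {ι X Z : Type*} [DecidableEq ι] [TopologicalSpace X] [TopologicalSpace Z]
    (f : (ι → X) → Z) (S : Finset ι) (F : (ι → StoneCech X) → Z) : Prop where
  apply_unit : ∀ x : ι → X, F (fun i => stoneCechUnit (x i)) = f x
  continuous_update : ∀ c : ι → StoneCech X, (∀ i ∉ S, c i ∈ range stoneCechUnit) → ∀ i ∈ S,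
    Continuous fun y => F (update c i y)

namespace IsSepExtension

variable {ι X Z : Type*} [DecidableEq ι] [TopologicalSpace X] [TopologicalSpace Z]
  {f : (ι → X) → Z} {S S' : Finset ι} {F F' : (ι → StoneCech X) → Z}

theorem continuous_of_eq_update (hF : IsSepExtension f S F) {C : StoneCech X → ι → StoneCech X}
    {i : ι} (hi : i ∈ S) (c : ι → StoneCech X) (hc : ∀ k ∉ S, c k ∈ range stoneCechUnit)
    (hC : ∀ b, C b = update c i b) : Continuous fun b => F (C b) := by
  simpa only [hC] using hF.continuous_update c hc i hi

/-- `X` is dense in `β X` and `Z` is Hausdorff, so agreement on `X ^ ι` propagates one coordinate of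
`T` at a time. -/
theorem eq_of_subset [T2Space Z] (hF : IsSepExtension f S F) (hF' : IsSepExtension f S' F')
    (T : Finset ι) (hT : T ⊆ S) (hT' : T ⊆ S') (c : ι → StoneCech X)
    (hc : ∀ i ∉ T, c i ∈ range stoneCechUnit) : F c = F' c := by
  induction T using Finset.induction_on generalizing c with
  | empty =>
    choose x hx using fun i => hc i (Finset.notMem_empty i)
    obtain rfl : (fun i => stoneCechUnit (x i)) = c := funext hx
    rw [hF.apply_unit, hF'.apply_unit]
  | insert i T hi ih =>
    have h : (fun y => F (update c i y)) = fun y => F' (update c i y) := by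
      refine stoneCech_hom_ext
        (hF.continuous_update c (fun k hk => hc k fun h => hk (hT h)) i (hT (by simp)))
        (hF'.continuous_update c (fun k hk => hc k fun h => hk (hT' h)) i (hT' (by simp)))
        (funext fun x => ih ((Finset.subset_insert _ _).trans hT)
          ((Finset.subset_insert _ _).trans hT') _ fun k hk => ?_)
      rcases eq_or_ne k i with rfl | hki
      · simp
      · rw [update_of_ne hki]
        exact hc k (by simp [hki, hk])
    simpa using congrFun h (c i)

theorem continuous_update_unit [PseudocompactSpace X] [CompactSpace Z] [T2Space Z]
    (hf : Continuous f) {j : ι} (hj : j ∈ S) (H : ∀ T ⊂ S, ∃ F, IsSepExtension f T F)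
    (hF : IsSepExtension f (S.erase j) F) (c : ι → StoneCech X)
    (hc : ∀ i ∉ S, c i ∈ range stoneCechUnit) :
    Continuous fun x : X => F (update c j (stoneCechUnit x)) := by
  cases isEmpty_or_nonempty X
  · exact continuous_of_const fun x => isEmptyElim x
  have hx₀ : ∀ k, ∃ x : X, k ∉ S → stoneCechUnit x = c k := fun k => by
    by_cases hk : k ∈ S
    · exact ⟨Classical.arbitrary X, fun h => (h hk).elim⟩
    · obtain ⟨x, hx⟩ := hc k hk
      exact ⟨x, fun _ => hx⟩
  choose x₀ hx₀ using hx₀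
  by_cases hi : ∃ i ∈ S, i ≠ j
  · obtain ⟨i, hi, hij⟩ := hi
    refine continuous_of_forall_continuous_comp fun φ hφ => ?_
    by_cases hl : ∃ l ∈ S, l ≠ i ∧ l ≠ j
    · obtain ⟨l, hl, hli, hlj⟩ := hl
      obtain ⟨F₁, hF₁⟩ := H _ (Finset.erase_ssubset hl)
      obtain ⟨F₂, hF₂⟩ := H _ (Finset.erase_ssubset hi)
      -- The extensions `F₁`, `F₂`, `F` confine to `X` the variables `l`, `i`, `j` respectively;
      -- they agree where their domains of control overlap.
      let u : StoneCech X → StoneCech X → StoneCech X → ι → StoneCech X :=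
        fun a b z => update (update (update c l a) i b) j z
      have hul : ∀ a b z a', u a' b z = update (u a b z) l a' := fun a b z a' => by
        ext k; simp only [u, update_apply]; grind
      have hui : ∀ a b z b', u a b' z = update (u a b z) i b' := fun a b z b' => by
        ext k; simp only [u, update_apply]; grind
      have huj : ∀ a b z z', u a b z' = update (u a b z) j z' := fun a b z z' => by
        ext k; simp only [u, update_apply]; grind
      have hmem : ∀ (T : Finset ι) (a b z : StoneCech X), (∀ k ∈ S, k ∉ T → k = l ∨ k = i ∨ k = j) →
          (l ∉ T → a ∈ range (stoneCechUnit : X → _)) →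
          (i ∉ T → b ∈ range (stoneCechUnit : X → _)) →
          (j ∉ T → z ∈ range (stoneCechUnit : X → _)) →
          ∀ k ∉ T, u a b z k ∈ range (stoneCechUnit : X → _) := by
        intro T a b z hT ha hb hz k hk
        simp only [u, update_apply]
        split_ifs with h₁ h₂ h₃
        · exact hz (h₁ ▸ hk)
        · exact hb (h₂ ▸ hk)
        · exact ha (h₃ ▸ hk)
        · exact hc k fun hkS => by grind
      have key := PseudocompactSpace.continuous_of_three_variables
        (continuous_stoneCechUnit (α := X)) denseRange_stoneCechUnit
        (fun x b z => φ (F₁ (u (stoneCechUnit x) b z)))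
        (fun a y z => φ (F₂ (u a (stoneCechUnit y) z)))
        (fun a b x => φ (F (u a b (stoneCechUnit x))))
        (fun x b z => congrArg φ (hF₁.eq_of_subset hF ((S.erase l).erase j)
          (Finset.erase_subset _ _) (by rw [Finset.erase_right_comm]; exact Finset.erase_subset _ _)
          _ (hmem _ _ _ _ (by grind) (by simp) (by grind) (by simp))))
        (fun x y z => congrArg φ (hF₁.eq_of_subset hF₂ ((S.erase l).erase i)
          (Finset.erase_subset _ _) (by rw [Finset.erase_right_comm]; exact Finset.erase_subset _ _)
          _ (hmem _ _ _ _ (by grind) (by simp) (by simp) (by simp))))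
        (fun x z => hφ.comp (hF₁.continuous_of_eq_update (i := i) (by grind)
          (u (stoneCechUnit x) (c i) z)
          (hmem _ _ _ _ (by grind) (by simp) (by grind) (by grind)) fun b => hui _ _ _ b))
        (fun x b => hφ.comp (hF₁.continuous_of_eq_update (i := j) (by grind)
          (u (stoneCechUnit x) b (c j))
          (hmem _ _ _ _ (by grind) (by simp) (by grind) (by grind)) fun z => huj _ _ _ z))
        (fun y z => hφ.comp (hF₂.continuous_of_eq_update (i := l) (by grind)
          (u (c l) (stoneCechUnit y) z)
          (hmem _ _ _ _ (by grind) (by grind) (by simp) (by grind)) fun a => hul _ _ _ a))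
        (fun a y => hφ.comp (hF₂.continuous_of_eq_update (i := j) (by grind)
          (u a (stoneCechUnit y) (c j))
          (hmem _ _ _ _ (by grind) (by grind) (by simp) (by grind)) fun z => huj _ _ _ z))
        (fun b z => hφ.comp (hF.continuous_of_eq_update (i := l) (by grind)
          (u (c l) b (stoneCechUnit z))
          (hmem _ _ _ _ (by grind) (by grind) (by grind) (by simp)) fun a => hul _ _ _ a))
        (c l) (c i)
      simpa [u] using key
    -- Here `S = {i, j}`, and joint continuity of `f` is needed.
    · push Not at hl
      have hFf : ∀ y x, F (update (update c i (stoneCechUnit y)) j (stoneCechUnit x)) =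
          f (update (update x₀ i y) j x) := fun y x => by
        rw [← hF.apply_unit]
        congr 1
        ext k
        simp only [update_apply]
        grind
      have key := PseudocompactSpace.continuous_right_of_continuous
        (X := X) (Y := X) denseRange_stoneCechUnit
        (fun b x => φ (F (update (update c i b) j (stoneCechUnit x))))
        (fun x => hφ.comp (hF.continuous_of_eq_update (i := i) (by grind)
          (update c j (stoneCechUnit x))
          (fun k hk => by
            rw [update_apply]
            split_ifs with h
            · simp
            · exact hc k (by grind))
          fun b => update_comm hij _ _ _))
        (by
          simp only [hFf]
          exact hφ.comp (hf.comp (by fun_prop)))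
        (c i)
      simpa using key
  · push Not at hi
    have hFf : ∀ x, F (update c j (stoneCechUnit x)) = f (update x₀ j x) := fun x => by
      rw [← hF.apply_unit]
      congr 1
      ext k
      simp only [update_apply]
      grind
    simp only [hFf]
    exact hf.comp (by fun_prop)

end IsSepExtension

/-- A continuous map from a finite power of a pseudocompact space `X` to a compact space extends
to a separately continuous map on the power of `β X`. -/
theorem PseudocompactSpace.exists_isSepExtension {ι X Z : Type*} [DecidableEq ι]
    [TopologicalSpace X] [PseudocompactSpace X] [TopologicalSpace Z] [CompactSpace Z] [T2Space Z]
    {f : (ι → X) → Z} (hf : Continuous f) (S : Finset ι) : ∃ F, IsSepExtension f S F := by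
  induction S using Finset.strongInduction with
  | H S ih =>
  rcases S.eq_empty_or_nonempty with rfl | ⟨j, hj⟩
  -- For empty `S` no continuity is required, so any retraction of sets will do.
  · obtain ⟨g, hg⟩ : ∃ g : StoneCech X → X, LeftInverse g stoneCechUnit := by
      cases isEmpty_or_nonempty X
      · have : IsEmpty (StoneCech X) :=
          not_nonempty_iff.1 fun h => not_nonempty_iff.2 ‹IsEmpty X›
            (denseRange_stoneCechUnit.nonempty_iff.2 h)
        exact ⟨isEmptyElim, fun x => isEmptyElim x⟩
      · exact ⟨_, leftInverse_invFun injective_stoneCechUnit_of_t35Space⟩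
    exact ⟨fun c => f fun i => g (c i), ⟨fun x => by simp only [hg _], by simp⟩⟩
  · obtain ⟨F', hF'⟩ := ih _ (Finset.erase_ssubset hj)
    have hcont : ∀ c : ι → StoneCech X, (∀ i ∉ S, c i ∈ range stoneCechUnit) →
        Continuous fun x : X => F' (update c j (stoneCechUnit x)) :=
      hF'.continuous_update_unit hf hj ih
    classical
    -- The fallback value is never used when the variables outside `S` lie in `X`.
    let F : (ι → StoneCech X) → Z := fun c =>
      if h : Continuous fun x : X => F' (update c j (stoneCechUnit x)) then
        stoneCechExtend h (c j) else F' c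
    have hFj : ∀ c : ι → StoneCech X, ∀ h : (∀ i ∉ S, c i ∈ range stoneCechUnit), ∀ y,
        F (update c j y) = stoneCechExtend (hcont c h) y := fun c h y => by
      simp [F, hcont c h]
    have hFx : ∀ c : ι → StoneCech X, (∀ i ∉ S, c i ∈ range stoneCechUnit) → ∀ x,
        F (update c j (stoneCechUnit x)) = F' (update c j (stoneCechUnit x)) := fun c h x => by
      rw [hFj c h, stoneCechExtend_stoneCechUnit]
    refine ⟨F, fun x => ?_, fun c hc i hi => ?_⟩
    · have := hFx (fun i => stoneCechUnit (x i)) (by simp) (x j)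
      rw [← hF'.apply_unit]
      simpa using this
    · rcases eq_or_ne i j with rfl | hij
      · simp only [hFj c hc]
        exact continuous_stoneCechExtend _
      · have hc' : ∀ b, ∀ k ∉ S, update c i b k ∈ range stoneCechUnit := fun b k hk => by
          rw [update_of_ne (by grind)]
          exact hc k hk
        refine continuous_of_forall_continuous_comp fun φ hφ => ?_
        have key := PseudocompactSpace.continuous_right_of_compactSpace
          (continuous_stoneCechUnit (α := X)) denseRange_stoneCechUnit
          (fun a b => φ (F (update (update c i b) j a)))
          (fun b => by
            simp only [hFj _ (hc' b)]
            exact hφ.comp (continuous_stoneCechExtend _))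
          (fun x => by
            simp only [hFx _ (hc' _)]
            refine hφ.comp (hF'.continuous_of_eq_update (i := i) (by grind)
              (update c j (stoneCechUnit x)) (fun k hk => ?_) fun b => update_comm hij _ _ _)
            rw [update_apply]
            split_ifs with h
            · simp
            · exact hc k (by grind))
          (c j)
        simpa [update_comm hij] using key

/-! ### Continuity in the symbol -/

/-- A closed subspace of a Hausdorff `k`-space is a `k`-space. -/
theorem CompactlyCoherentSpace.subtype {E : Type*} [TopologicalSpace E] [T2Space E]
    [CompactlyCoherentSpace E] {p : E → Prop} (hp : IsClosed {x | p x}) :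
    CompactlyCoherentSpace (Subtype p) := by
  refine .of_isClosed fun A hA => ?_
  have hemb : IsClosedEmbedding (Subtype.val : Subtype p → E) := hp.isClosedEmbedding_subtypeVal
  rw [hemb.isClosed_iff_image_isClosed, CompactlyCoherentSpace.isClosed_iff]
  intro K hK
  have hK' : IsCompact ((Subtype.val : Subtype p → E) ⁻¹' K) := hemb.isCompact_preimage hK
  have hA' : IsCompact (A ∩ (Subtype.val : Subtype p → E) ⁻¹' K) := by
    have := isCompact_iff_compactSpace.1 hK'
    have h := (hA _ hK').isCompact.image continuous_subtype_val
    rwa [Subtype.image_preimage_coe, inter_comm] at h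
  have h := (hA'.image continuous_subtype_val).isClosed.preimage
    (continuous_subtype_val : Continuous (Subtype.val : K → E))
  convert h using 1
  ext ⟨x, hx⟩
  simp [hx]

/-- `CompactlyCoherentSpace E` says that `E` is a `k`-space. The canonical dense embedding
`stoneCechUnit : X → StoneCech X` being a homomorphism says that the operations on `StoneCech X`
extend those of `X`. -/
theorem corollaryc {E X : Type*} [TopologicalSpace E] [T35Space E] [CompactlyCoherentSpace E]
    [TopologicalSpace X] [PseudocompactSpace X]
    (σ : ContinuousSignature E) (A : EAlgebra σ X) (hA : A.IsTopological) :
    ∃ B : EAlgebra σ (StoneCech X),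
      B.IsSemitopological ∧ A.IsHom B (stoneCechUnit : X → StoneCech X) := by
  have hf : ∀ n (t : σ.Symbols n), Continuous fun x => stoneCechUnit (A.op n (t, x)) := fun n t =>
    continuous_stoneCechUnit.comp ((hA n).comp (by fun_prop))
  choose F hF using fun n t => PseudocompactSpace.exists_isSepExtension (hf n t) Finset.univ
  refine ⟨⟨fun n z => F n z.1 z.2⟩, fun n => ⟨fun c => ?_, fun t c i => ?_⟩, fun n t x => ?_⟩
  · have : CompactlyCoherentSpace (σ.Symbols n) := .subtype (σ.isClopen_fiber n).1
    -- Induction on the set of coordinates allowed to leave `X`; each step is tested on compact sets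
    -- of symbols.
    suffices h : ∀ T : Finset (Fin n), ∀ c : Fin n → StoneCech X,
        (∀ i ∉ T, c i ∈ range stoneCechUnit) → Continuous fun t => F n t c from
      h Finset.univ c (by simp)
    intro T
    induction T using Finset.induction_on with
    | empty =>
      intro c hc
      choose x hx using fun i => hc i (Finset.notMem_empty i)
      obtain rfl : (fun i => stoneCechUnit (x i)) = c := funext hx
      simp only [(hF n _).apply_unit]
      exact continuous_stoneCechUnit.comp ((hA n).comp (by fun_prop))
    | insert i T hi ih =>
      intro c hc
      refine (CompactlyCoherentSpace.isCoherentWith.continuous_iff).2 fun K hK => ?_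
      rw [continuousOn_iff_continuous_domRestrict]
      have : CompactSpace K := isCompact_iff_compactSpace.1 hK
      refine continuous_of_forall_continuous_comp fun φ hφ => ?_
      have key := PseudocompactSpace.continuous_right_of_compactSpace
        (continuous_stoneCechUnit (α := X)) denseRange_stoneCechUnit
        (fun a (t : K) => φ (F n t (update c i a)))
        (fun t => hφ.comp ((hF n t).continuous_update c (by simp) i (Finset.mem_univ i)))
        (fun x => hφ.comp ((ih _ fun k hk => by
          rw [update_apply]
          split_ifs with h
          · simp
          · exact hc k (by simp [h, hk])).comp continuous_subtype_val)) (c i)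
      simpa using key
  · exact (hF n t).continuous_update c (by simp) i (Finset.mem_univ i)
  · exact ((hF n t).apply_unit x).symm
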